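/- Let $(X,\Sigma,\mu)$ be a complete $\sigma$-finite measure space and let $\mathcal A\subseteq\Sigma$ be a sub-$\sigma$-algebra such that $(X,\mathcal A,\mu|_{\mathcal A})$ is complete, $\sigma$-finite and non-atomic (there is no $A\in\mathcal A$ with $\mu(A)>0$ such that every $F\in\mathcal A$ with $F\subseteq A$ satisfies $\mu(F)=0$ or $\mu(F)=\mu(A)$). Let $E$ be the conditional expectation with respect to $\mathcal A$, defined on the space $D(E)$ of all (classes of) $\Sigma$-measurable functions $f:X\to\mathbb C$ for which $E(|f|)<\infty$ almost everywhere, and for $f,g\in D(E)$ put $$f*g=fE(g)+gE(f)-E(f)E(g).$$ Let $\Phi:\mathbb R\to[0,\infty)$ be a Young function, i.e. $\Phi$ is continuous, convex and even, $\Phi(0)=0$ and $\lim_{x\to\infty}\Phi(x)=\infty$, and suppose that it satisfies the global $\Delta_2$-condition: there is $k>0$ with $\Phi(2x)\le k\,\Phi(x)$ for all $x\ge 0$. Let $$L^\Phi(\Sigma)=\Big\{f:X\to\mathbb C\ \ \Sigma\text{-measurable}:\ \int_X\Phi(\varepsilon|f|)\,d\mu<\infty\text{ for some }\varepsilon>0\Big\}$$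 be the Orlicz space (functions equal almost everywhere being identified), with the norm $\|f\|_\Phi=\inf\{\varepsilon>0:\int_X\Phi(|f|/\varepsilon)\,d\mu\le1\}$. Let $u\in D(E)$ be a Lambert multiplier of $L^\Phi(\Sigma)$, i.e. $u*f\in L^\Phi(\Sigma)$ for every $f\in L^\Phi(\Sigma)$, and let $T_u:L^\Phi(\Sigma)\to L^\Phi(\Sigma)$, $T_uf=u*f$. If $T_u$ is Fredholm, i.e. its range is closed, its kernel has finite dimension and its range has finite codimension, then there is $\delta>0$ such that $|E(u)|\ge\delta$ almost everywhere on $X$. -/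

import Mathlib

noncomputable section

open MeasureTheory
open scoped ENNReal

namespace LambertOrlicz

/-! ### Young functions -/

/-- A Young function: a continuous, convex, even function `Φ : ℝ → [0, ∞)` with `Φ 0 = 0` and
`Φ x → ∞` as `x → ∞`. -/
structure YoungFunction where
  toFun : ℝ → ℝ
  nonneg' : ∀ x, 0 ≤ toFun x
  continuous' : Continuous toFun
  convex' : ConvexOn ℝ Set.univ toFun
  even' : ∀ x, toFun (-x) = toFun x
  map_zero' : toFun 0 = 0
  tendsto' : Filter.Tendsto toFun Filter.atTop Filter.atTop

instance : CoeFun YoungFunction (fun _ => ℝ → ℝ) := ⟨YoungFunction.toFun⟩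

/-- The (global) `Δ₂`-condition: `Φ (2 x) ≤ k Φ x` for all `x ≥ 0`, for some constant `k > 0`. -/
def YoungFunction.DeltaTwo (Φ : YoungFunction) : Prop :=
  ∃ k : ℝ, 0 < k ∧ ∀ x : ℝ, 0 ≤ x → Φ (2 * x) ≤ k * Φ x

lemma YoungFunction.scale (Φ : YoungFunction) {t : ℝ} (h0 : 0 ≤ t) (h1 : t ≤ 1) (x : ℝ) :
    Φ (t * x) ≤ t * Φ x := by
  have h := Φ.convex'.2 (Set.mem_univ x) (Set.mem_univ (0 : ℝ)) h0 (sub_nonneg.2 h1) (by ring)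
  simpa [Φ.map_zero'] using h

lemma YoungFunction.mono (Φ : YoungFunction) {x y : ℝ} (hx : 0 ≤ x) (hxy : x ≤ y) :
    Φ x ≤ Φ y := by
  rcases (hx.trans hxy).eq_or_lt with h | h
  · have : x = y := by linarith
    rw [this]
  · have h1 : x / y ≤ 1 := (div_le_one h).2 hxy
    have h2 := Φ.scale (div_nonneg hx h.le) h1 y
    rw [div_mul_cancel₀ _ h.ne'] at h2
    nlinarith [Φ.nonneg' y]

variable {X : Type*}

/-! ### Orlicz spaces -/

section Orlicz

variable {mX : MeasurableSpace X} {μ : Measure X}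

/-- The integral `∫ Φ(c |f|) dμ ∈ [0, ∞]`. -/
def modular (Φ : YoungFunction) (c : ℝ) (f : X →ₘ[μ] ℂ) : ℝ≥0∞ :=
  ∫⁻ x, ENNReal.ofReal (Φ (c * ‖f x‖)) ∂μ

lemma aemeasurable_modular (Φ : YoungFunction) (c : ℝ) (f : X →ₘ[μ] ℂ) :
    AEMeasurable (fun x => ENNReal.ofReal (Φ (c * ‖f x‖))) μ := by
  have h : AEMeasurable (fun x => c * ‖f x‖) μ := f.aemeasurable.norm.const_mul c
  exact (Φ.continuous'.measurable.comp_aemeasurable h).ennreal_ofReal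

lemma modular_mono (Φ : YoungFunction) {c d : ℝ} (hc : 0 ≤ c) (hcd : c ≤ d) (f : X →ₘ[μ] ℂ) :
    modular Φ c f ≤ modular Φ d f :=
  lintegral_mono fun x => ENNReal.ofReal_le_ofReal
    (Φ.mono (by positivity) (mul_le_mul_of_nonneg_right hcd (norm_nonneg _)))

lemma modular_scale (Φ : YoungFunction) {t : ℝ} (h0 : 0 ≤ t) (h1 : t ≤ 1) (c : ℝ)
    (f : X →ₘ[μ] ℂ) : modular Φ (t * c) f ≤ ENNReal.ofReal t * modular Φ c f := by
  unfold modular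
  rw [← lintegral_const_mul'' _ (aemeasurable_modular Φ c f)]
  refine lintegral_mono fun x => ?_
  rw [← ENNReal.ofReal_mul h0, mul_assoc]
  exact ENNReal.ofReal_le_ofReal (Φ.scale h0 h1 _)

lemma modular_zero (Φ : YoungFunction) (c : ℝ) : modular Φ c (0 : X →ₘ[μ] ℂ) = 0 := by
  unfold modular
  rw [lintegral_congr_ae (g := fun _ => 0)]
  · simp
  · filter_upwards [AEEqFun.coeFn_zero (μ := μ) (β := ℂ) (α := X)] with x hx
    simp [hx, Φ.map_zero']

lemma modular_smul (Φ : YoungFunction) (c : ℝ) (a : ℂ) (f : X →ₘ[μ] ℂ) :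
    modular Φ c (a • f) = modular Φ (c * ‖a‖) f := by
  unfold modular
  refine lintegral_congr_ae ?_
  filter_upwards [AEEqFun.coeFn_smul a f] with x hx
  simp [hx, mul_assoc]

/-- Convexity of the modular. -/
lemma modular_add_le (Φ : YoungFunction) {a b : ℝ} (ha : 0 < a) (hb : 0 < b) (f g : X →ₘ[μ] ℂ) :
    modular Φ (a + b)⁻¹ (f + g) ≤ ENNReal.ofReal (a / (a + b)) * modular Φ a⁻¹ f
      + ENNReal.ofReal (b / (a + b)) * modular Φ b⁻¹ g := by
  unfold modular
  rw [← lintegral_const_mul'' _ (aemeasurable_modular Φ _ f),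
    ← lintegral_const_mul'' _ (aemeasurable_modular Φ _ g),
    ← lintegral_add_left' ((aemeasurable_modular Φ _ f).const_mul _)]
  refine lintegral_mono_ae ?_
  filter_upwards [AEEqFun.coeFn_add f g] with x hx
  have hab : 0 < a + b := add_pos ha hb
  rw [← ENNReal.ofReal_mul (by positivity), ← ENNReal.ofReal_mul (by positivity),
    ← ENNReal.ofReal_add (mul_nonneg (by positivity) (Φ.nonneg' _))
      (mul_nonneg (by positivity) (Φ.nonneg' _))]
  refine ENNReal.ofReal_le_ofReal ?_
  have h := Φ.convex'.2 (Set.mem_univ (a⁻¹ * ‖f x‖)) (Set.mem_univ (b⁻¹ * ‖g x‖))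
    (show 0 ≤ a / (a + b) by positivity) (show 0 ≤ b / (a + b) by positivity)
    (by field_simp)
  refine (Φ.mono (by positivity) ?_).trans h
  rw [hx, Pi.add_apply, smul_eq_mul, smul_eq_mul]
  have e : a / (a + b) * (a⁻¹ * ‖f x‖) + b / (a + b) * (b⁻¹ * ‖g x‖)
      = (a + b)⁻¹ * (‖f x‖ + ‖g x‖) := by field_simp
  rw [e]
  exact mul_le_mul_of_nonneg_left (norm_add_le _ _) (by positivity)

variable (μ) in
/-- The Orlicz space `L^Φ`: classes of measurable `f : X → ℂ` with `∫ Φ(ε |f|) dμ < ∞` for some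
`ε > 0`. -/
def orliczSpace (Φ : YoungFunction) : Submodule ℂ (X →ₘ[μ] ℂ) where
  carrier := {f | ∃ ε : ℝ, 0 < ε ∧ modular Φ ε f < ∞}
  zero_mem' := ⟨1, one_pos, by simp [modular_zero]⟩
  add_mem' := by
    rintro f g ⟨a, ha, hf⟩ ⟨b, hb, hg⟩
    refine ⟨(a⁻¹ + b⁻¹)⁻¹, by positivity, ?_⟩
    refine (modular_add_le Φ (inv_pos.2 ha) (inv_pos.2 hb) f g).trans_lt ?_
    rw [inv_inv, inv_inv]
    exact ENNReal.add_lt_top.2 ⟨ENNReal.mul_lt_top ENNReal.ofReal_lt_top hf,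
      ENNReal.mul_lt_top ENNReal.ofReal_lt_top hg⟩
  smul_mem' := by
    rintro c f ⟨a, ha, hf⟩
    refine ⟨a / (‖c‖ + 1), by positivity, ?_⟩
    rw [modular_smul]
    refine (modular_mono Φ (by positivity) ?_ f).trans_lt hf
    rw [div_mul_eq_mul_div, div_le_iff₀ (by positivity)]
    nlinarith [norm_nonneg c]

/-- The Luxemburg norm `‖f‖_Φ = inf {ε > 0 : ∫ Φ(|f| / ε) dμ ≤ 1}`. -/
def luxemburgNorm (Φ : YoungFunction) (f : X →ₘ[μ] ℂ) : ℝ :=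
  sInf {ε : ℝ | 0 < ε ∧ ∫⁻ x, ENNReal.ofReal (Φ (‖f x‖ / ε)) ∂μ ≤ 1}

lemma luxemburgNorm_eq (Φ : YoungFunction) (f : X →ₘ[μ] ℂ) :
    luxemburgNorm Φ f = sInf {ε : ℝ | 0 < ε ∧ modular Φ ε⁻¹ f ≤ 1} := by
  simp only [luxemburgNorm, modular, div_eq_inv_mul]

lemma luxemburgNorm_le {Φ : YoungFunction} {f : X →ₘ[μ] ℂ} {a : ℝ} (ha : 0 < a)
    (h : modular Φ a⁻¹ f ≤ 1) : luxemburgNorm Φ f ≤ a := by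
  rw [luxemburgNorm_eq]
  exact csInf_le ⟨0, fun x hx => hx.1.le⟩ ⟨ha, h⟩

lemma luxemburgNorm_nonneg (Φ : YoungFunction) (f : X →ₘ[μ] ℂ) : 0 ≤ luxemburgNorm Φ f :=
  Real.sInf_nonneg fun _ hx => hx.1.le

lemma exists_modular_le_one {Φ : YoungFunction} {f : X →ₘ[μ] ℂ} (hf : f ∈ orliczSpace μ Φ) :
    {ε : ℝ | 0 < ε ∧ modular Φ ε⁻¹ f ≤ 1}.Nonempty := by
  obtain ⟨c, hc, hf⟩ := hf
  set M := (modular Φ c f).toReal with hM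
  have hM0 : 0 ≤ M := ENNReal.toReal_nonneg
  have h1 : (1 + M)⁻¹ ≤ 1 := inv_le_one_of_one_le₀ (by linarith)
  refine ⟨((1 + M)⁻¹ * c)⁻¹, by positivity, ?_⟩
  rw [inv_inv]
  refine (modular_scale Φ (by positivity) h1 c f).trans ?_
  rw [← ENNReal.ofReal_toReal hf.ne, ← hM, ← ENNReal.ofReal_mul (by positivity),
    ← ENNReal.ofReal_one]
  refine ENNReal.ofReal_le_ofReal ?_
  rw [inv_mul_le_iff₀ (by positivity)]
  linarith

lemma luxemburgNorm_add_le {Φ : YoungFunction} {f g : X →ₘ[μ] ℂ} (hf : f ∈ orliczSpace μ Φ)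
    (hg : g ∈ orliczSpace μ Φ) :
    luxemburgNorm Φ (f + g) ≤ luxemburgNorm Φ f + luxemburgNorm Φ g := by
  have key : ∀ a ∈ {ε : ℝ | 0 < ε ∧ modular Φ ε⁻¹ f ≤ 1},
      ∀ b ∈ {ε : ℝ | 0 < ε ∧ modular Φ ε⁻¹ g ≤ 1}, luxemburgNorm Φ (f + g) ≤ a + b := by
    rintro a ⟨ha, hfa⟩ b ⟨hb, hgb⟩
    refine luxemburgNorm_le (add_pos ha hb) ((modular_add_le Φ ha hb f g).trans ?_)
    calc _ ≤ ENNReal.ofReal (a / (a + b)) * 1 + ENNReal.ofReal (b / (a + b)) * 1 := by gcongr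
      _ = 1 := by
        rw [mul_one, mul_one, ← ENNReal.ofReal_add (by positivity) (by positivity),
          ← ENNReal.ofReal_one]
        congr 1
        field_simp
  rw [luxemburgNorm_eq Φ f, luxemburgNorm_eq Φ g]
  have h1 : ∀ a ∈ {ε : ℝ | 0 < ε ∧ modular Φ ε⁻¹ f ≤ 1},
      luxemburgNorm Φ (f + g) - a ≤ sInf {ε : ℝ | 0 < ε ∧ modular Φ ε⁻¹ g ≤ 1} := fun a ha =>
    le_csInf (exists_modular_le_one hg) fun b hb => by linarith [key a ha b hb]
  have h2 : luxemburgNorm Φ (f + g) - sInf {ε : ℝ | 0 < ε ∧ modular Φ ε⁻¹ g ≤ 1}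
      ≤ sInf {ε : ℝ | 0 < ε ∧ modular Φ ε⁻¹ f ≤ 1} :=
    le_csInf (exists_modular_le_one hf) fun a ha => by linarith [h1 a ha]
  linarith

lemma luxemburgNorm_zero (Φ : YoungFunction) : luxemburgNorm Φ (0 : X →ₘ[μ] ℂ) = 0 := by
  refine le_antisymm (le_of_forall_pos_le_add fun ε hε => ?_) (luxemburgNorm_nonneg _ _)
  rw [zero_add]
  exact luxemburgNorm_le hε (by simp [modular_zero])

lemma luxemburgNorm_smul_le {Φ : YoungFunction} (c : ℂ) {f : X →ₘ[μ] ℂ}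
    (hf : f ∈ orliczSpace μ Φ) : luxemburgNorm Φ (c • f) ≤ ‖c‖ * luxemburgNorm Φ f := by
  rcases eq_or_ne c 0 with rfl | hc
  · rw [zero_smul ℂ f, luxemburgNorm_zero, norm_zero, zero_mul]
  have hc' : 0 < ‖c‖ := norm_pos_iff.2 hc
  rw [← div_le_iff₀' hc', luxemburgNorm_eq Φ f]
  refine le_csInf (exists_modular_le_one hf) ?_
  rintro a ⟨ha, hfa⟩
  rw [div_le_iff₀' hc']
  refine luxemburgNorm_le (by positivity) ?_
  rw [modular_smul, mul_inv, mul_right_comm, inv_mul_cancel₀ hc'.ne', one_mul]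
  exact hfa

lemma modular_le_one_of_norm_lt {Φ : YoungFunction} {f : X →ₘ[μ] ℂ} (hf : f ∈ orliczSpace μ Φ)
    {a : ℝ} (h : luxemburgNorm Φ f < a) : modular Φ a⁻¹ f ≤ 1 := by
  rw [luxemburgNorm_eq] at h
  obtain ⟨b, ⟨hb, hfb⟩, hba⟩ := exists_lt_of_csInf_lt (exists_modular_le_one hf) h
  exact (modular_mono Φ (inv_nonneg.2 (hb.trans hba).le) (inv_anti₀ hb hba.le) f).trans hfb

lemma eq_zero_of_luxemburgNorm {Φ : YoungFunction} {f : X →ₘ[μ] ℂ} (hf : f ∈ orliczSpace μ Φ)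
    (h : luxemburgNorm Φ f = 0) : f = 0 := by
  have h1 : ∀ c : ℝ, 0 < c → modular Φ c f ≤ 1 := fun c hc => by
    have := modular_le_one_of_norm_lt hf (a := c⁻¹) (by rw [h]; positivity)
    rwa [inv_inv] at this
  have h2 : ∀ c : ℝ, 0 < c → modular Φ c f = 0 := fun c hc => by
    refine le_antisymm (ENNReal.le_of_forall_pos_le_add fun ε hε _ => ?_) zero_le
    have hε' : (0 : ℝ) < ε := hε
    set t : ℝ := min ε 1 with ht
    have ht0 : 0 < t := lt_min hε' one_pos
    have := modular_scale Φ ht0.le (min_le_right _ _) (t⁻¹ * c) f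
    rw [← mul_assoc, mul_inv_cancel₀ ht0.ne', one_mul] at this
    rw [zero_add]
    calc modular Φ c f ≤ ENNReal.ofReal t * modular Φ (t⁻¹ * c) f := this
      _ ≤ ENNReal.ofReal ε * 1 := by
        gcongr
        · exact min_le_left _ _
        · exact h1 _ (by positivity)
      _ = ε := by simp
  have h3 : ∀ᵐ x ∂μ, ∀ n : ℕ, Φ (((n : ℝ) + 1) * ‖f x‖) = 0 := by
    rw [ae_all_iff]
    intro n
    have := (lintegral_eq_zero_iff' (aemeasurable_modular Φ ((n : ℝ) + 1) f)).1
      (h2 _ (by positivity))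
    filter_upwards [this] with x hx
    exact le_antisymm (ENNReal.ofReal_eq_zero.1 hx) (Φ.nonneg' _)
  refine AEEqFun.ext ?_
  filter_upwards [h3, AEEqFun.coeFn_zero (μ := μ) (β := ℂ) (α := X)] with x hx h0
  rw [h0, Pi.zero_apply]
  by_contra hne
  have hpos : 0 < ‖f x‖ := norm_pos_iff.2 hne
  have hlim : Filter.Tendsto (fun n : ℕ => Φ (((n : ℝ) + 1) * ‖f x‖)) Filter.atTop Filter.atTop :=
    Φ.tendsto'.comp ((Filter.tendsto_atTop_add_const_right _ _
      tendsto_natCast_atTop_atTop).atTop_mul_const hpos)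
  obtain ⟨n, hn⟩ := (hlim.eventually_gt_atTop 0).exists
  exact hn.ne' (hx n)

/-- `L^Φ` is normed by the Luxemburg norm. -/
instance instNormedAddCommGroupOrlicz (Φ : YoungFunction) :
    NormedAddCommGroup (orliczSpace μ Φ) :=
  AddGroupNorm.toNormedAddCommGroup
    { toFun := fun f => luxemburgNorm Φ (f : X →ₘ[μ] ℂ)
      map_zero' := luxemburgNorm_zero Φ
      add_le' := fun f g => luxemburgNorm_add_le f.2 g.2
      neg' := fun f => by
        have h : ∀ g : orliczSpace μ Φ,
            luxemburgNorm Φ ((-g : orliczSpace μ Φ) : X →ₘ[μ] ℂ)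
              ≤ luxemburgNorm Φ (g : X →ₘ[μ] ℂ) := fun g => by
          have := luxemburgNorm_smul_le (-1) g.2
          rwa [neg_one_smul ℂ (g : X →ₘ[μ] ℂ), norm_neg, norm_one, one_mul] at this
        refine le_antisymm (h f) ?_
        simpa using h (-f)
      eq_zero_of_map_eq_zero' := fun f hf => Subtype.ext (eq_zero_of_luxemburgNorm f.2 hf) }

instance instNormedSpaceOrlicz (Φ : YoungFunction) : NormedSpace ℂ (orliczSpace μ Φ) where
  norm_smul_le c f := luxemburgNorm_smul_le c f.2

lemma orlicz_norm_def (Φ : YoungFunction) (f : orliczSpace μ Φ) :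
    ‖f‖ = luxemburgNorm Φ (f : X →ₘ[μ] ℂ) := rfl

end Orlicz

/-! ### Conditional expectation -/

section CondExp

variable (𝒜 : MeasurableSpace X) {mX : MeasurableSpace X} {μ : Measure X}

variable (μ) in
/-- The conditional expectation `E(g⁺) - E(g⁻)` of a real function, where the conditional
expectation of a function with values in `[0, ∞]` is the Radon-Nikodym one. -/
def condExpReal (g : X → ℝ) (x : X) : ℝ :=
  (condLExp 𝒜 μ (fun y => ENNReal.ofReal (g y)) x).toReal
    - (condLExp 𝒜 μ (fun y => ENNReal.ofReal (-g y)) x).toReal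

lemma measurable_condExpReal (g : X → ℝ) : Measurable (condExpReal 𝒜 μ g) :=
  (measurable_condLExp' 𝒜 μ _).ennreal_toReal.sub (measurable_condLExp' 𝒜 μ _).ennreal_toReal

/-- The conditional expectation `E(f) = E(Re f) + i E(Im f)` with respect to `𝒜`
(meaningful on the conditionable functions). -/
def condE (f : X →ₘ[μ] ℂ) : X →ₘ[μ] ℂ :=
  AEEqFun.mk
    (fun x => (condExpReal 𝒜 μ (fun y => (f y).re) x : ℂ)
      + (condExpReal 𝒜 μ (fun y => (f y).im) x : ℂ) * Complex.I)
    (((Complex.measurable_ofReal.comp (measurable_condExpReal 𝒜 _)).add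
      ((Complex.measurable_ofReal.comp
        (measurable_condExpReal 𝒜 _)).mul_const _)).aestronglyMeasurable)

/-- A real function has finite conditional expectation `E(|g|)`. -/
def FinCond (μ : Measure X) (g : X → ℝ) : Prop :=
  AEMeasurable g μ ∧ ∀ᵐ x ∂μ, condLExp 𝒜 μ (fun y => ENNReal.ofReal |g y|) x < ∞

variable {𝒜}

lemma condLExp_lt_top_of_le {p q : X → ℝ≥0∞} (hpq : p ≤ᵐ[μ] q)
    (hq : ∀ᵐ x ∂μ, condLExp 𝒜 μ q x < ∞) : ∀ᵐ x ∂μ, condLExp 𝒜 μ p x < ∞ := by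
  filter_upwards [condLExp_mono (mΩ := 𝒜) hpq, hq] with x h1 h2 using h1.trans_lt h2

lemma condLExp_add_lt_top {p q : X → ℝ≥0∞} (hpm : AEMeasurable p μ)
    (hp : ∀ᵐ x ∂μ, condLExp 𝒜 μ p x < ∞) (hq : ∀ᵐ x ∂μ, condLExp 𝒜 μ q x < ∞) :
    ∀ᵐ x ∂μ, condLExp 𝒜 μ (p + q) x < ∞ := by
  filter_upwards [condLExp_add_left (mΩ := 𝒜) q hpm, hp, hq] with x h h1 h2
  rw [h]
  exact ENNReal.add_lt_top.2 ⟨h1, h2⟩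

lemma condLExp_smul_lt_top {p : X → ℝ≥0∞} {c : ℝ≥0∞} (hc : c ≠ ∞)
    (hp : ∀ᵐ x ∂μ, condLExp 𝒜 μ p x < ∞) : ∀ᵐ x ∂μ, condLExp 𝒜 μ (c • p) x < ∞ := by
  filter_upwards [condLExp_smul' (mΩ := 𝒜) (P := μ) p hc, hp] with x h h1
  rw [h]
  exact ENNReal.mul_lt_top hc.lt_top h1

lemma condLExp_const_lt_top {c : ℝ≥0∞} (hc : c ≠ ∞) :
    ∀ᵐ x ∂μ, condLExp 𝒜 μ (fun _ => c) x < ∞ := by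
  by_cases hm : 𝒜 ≤ mX
  swap
  · simp [condLExp_of_not_le hm]
  by_cases hσ : SigmaFinite (μ.trim hm)
  swap
  · simp [condLExp_of_not_sigmaFinite hm hσ]
  simp [condLExp_const hm μ c, hc.lt_top]

lemma FinCond.pos {g : X → ℝ} (hg : FinCond 𝒜 μ g) :
    ∀ᵐ x ∂μ, condLExp 𝒜 μ (fun y => ENNReal.ofReal (g y)) x < ∞ :=
  condLExp_lt_top_of_le (ae_of_all _ fun _ => ENNReal.ofReal_le_ofReal (le_abs_self _)) hg.2

lemma FinCond.neg {g : X → ℝ} (hg : FinCond 𝒜 μ g) : FinCond 𝒜 μ (fun y => -g y) :=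
  ⟨hg.1.neg, by simpa using hg.2⟩

lemma FinCond.add {g h : X → ℝ} (hg : FinCond 𝒜 μ g) (hh : FinCond 𝒜 μ h) :
    FinCond 𝒜 μ (fun y => g y + h y) := by
  refine ⟨hg.1.add hh.1, ?_⟩
  refine condLExp_lt_top_of_le ?_
    (condLExp_add_lt_top (AEMeasurable.ennreal_ofReal (by simpa using hg.1.abs)) hg.2 hh.2)
  refine ae_of_all _ fun y => ?_
  simp only [Pi.add_apply]
  rw [← ENNReal.ofReal_add (abs_nonneg _) (abs_nonneg _)]
  exact ENNReal.ofReal_le_ofReal (abs_add_le _ _)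

lemma FinCond.const_mul {g : X → ℝ} (hg : FinCond 𝒜 μ g) (c : ℝ) :
    FinCond 𝒜 μ (fun y => c * g y) := by
  refine ⟨hg.1.const_mul c, ?_⟩
  refine condLExp_lt_top_of_le (ae_of_all _ fun y => ?_)
    (condLExp_smul_lt_top (c := ENNReal.ofReal |c|) ENNReal.ofReal_ne_top hg.2)
  simp only [Pi.smul_apply, smul_eq_mul]
  rw [← ENNReal.ofReal_mul (abs_nonneg _), abs_mul]

lemma condExpReal_congr {g h : X → ℝ} (hgh : g =ᵐ[μ] h) :
    condExpReal 𝒜 μ g =ᵐ[μ] condExpReal 𝒜 μ h := by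
  have h1 : (fun y => ENNReal.ofReal (g y)) =ᵐ[μ] fun y => ENNReal.ofReal (h y) := by
    filter_upwards [hgh] with y hy
    rw [hy]
  have h2 : (fun y => ENNReal.ofReal (-g y)) =ᵐ[μ] fun y => ENNReal.ofReal (-h y) := by
    filter_upwards [hgh] with y hy
    rw [hy]
  filter_upwards [condLExp_congr_ae (mΩ := 𝒜) h1, condLExp_congr_ae (mΩ := 𝒜) h2] with x e1 e2
  simp only [condExpReal, e1, e2]

lemma condExpReal_neg (g : X → ℝ) (x : X) :
    condExpReal 𝒜 μ (fun y => -g y) x = -condExpReal 𝒜 μ g x := by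
  simp [condExpReal]

lemma condExpReal_add {g h : X → ℝ} (hg : FinCond 𝒜 μ g) (hh : FinCond 𝒜 μ h) :
    condExpReal 𝒜 μ (fun y => g y + h y) =ᵐ[μ]
      fun x => condExpReal 𝒜 μ g x + condExpReal 𝒜 μ h x := by
  have hs := hg.add hh
  set P : (X → ℝ) → X → ℝ≥0∞ := fun k y => ENNReal.ofReal (k y) with hP
  have hPm : ∀ k : X → ℝ, AEMeasurable k μ → AEMeasurable (P k) μ := fun k hk => hk.ennreal_ofReal
  set s : X → ℝ := fun y => g y + h y with hsdef
  set ng : X → ℝ := fun y => -g y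
  set nh : X → ℝ := fun y => -h y
  set ns : X → ℝ := fun y => -s y
  have e : P s + (P ng + P nh) = P ns + (P g + P h) := by
    funext y
    simp only [hP, Pi.add_apply]
    rw [← ENNReal.toReal_eq_toReal_iff' (by simp [ENNReal.add_eq_top])
      (by simp [ENNReal.add_eq_top])]
    simp only [ENNReal.toReal_add, ENNReal.ofReal_ne_top, ENNReal.add_eq_top, ne_eq,
      not_false_eq_true, or_self, ENNReal.toReal_ofReal', s, ng, nh, ns]
    have hmax : ∀ t : ℝ, max t 0 - max (-t) 0 = t := fun t => by
      rcases le_total 0 t with a | a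
      · rw [max_eq_left a, max_eq_right (neg_nonpos.2 a), sub_zero]
      · rw [max_eq_right a, max_eq_left (neg_nonneg.2 a), zero_sub, neg_neg]
    linarith [hmax (g y), hmax (h y), hmax (g y + h y)]
  have a1 := condLExp_add_left (mΩ := 𝒜) (P ng + P nh) (hPm s hs.1)
  have a2 := condLExp_add_left (mΩ := 𝒜) (P nh) (hPm ng hg.neg.1)
  have a3 := condLExp_add_left (mΩ := 𝒜) (P g + P h) (hPm ns hs.neg.1)
  have a4 := condLExp_add_left (mΩ := 𝒜) (P h) (hPm g hg.1)
  rw [e] at a1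
  filter_upwards [a1, a2, a3, a4, hg.pos, hh.pos, hs.pos, hg.neg.pos, hh.neg.pos, hs.neg.pos]
    with x a1 a2 a3 a4 f1 f2 f3 f4 f5 f6
  rw [a3, Pi.add_apply, Pi.add_apply, a2, a4, Pi.add_apply, Pi.add_apply] at a1
  have := congrArg ENNReal.toReal a1
  rw [ENNReal.toReal_add f6.ne (ENNReal.add_lt_top.2 ⟨f1, f2⟩).ne,
    ENNReal.toReal_add f1.ne f2.ne,
    ENNReal.toReal_add f3.ne (ENNReal.add_lt_top.2 ⟨f4, f5⟩).ne,
    ENNReal.toReal_add f4.ne f5.ne] at this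
  simp only [condExpReal]
  linarith

lemma condExpReal_const_mul_of_nonneg (g : X → ℝ) {c : ℝ} (hc : 0 ≤ c) :
    condExpReal 𝒜 μ (fun y => c * g y) =ᵐ[μ] fun x => c * condExpReal 𝒜 μ g x := by
  have e1 : (fun y => ENNReal.ofReal (c * g y))
      = ENNReal.ofReal c • fun y => ENNReal.ofReal (g y) := by
    funext y
    simp [ENNReal.ofReal_mul hc]
  have e2 : (fun y => ENNReal.ofReal (-(c * g y)))
      = ENNReal.ofReal c • fun y => ENNReal.ofReal (-g y) := by
    funext y
    rw [← mul_neg, ENNReal.ofReal_mul hc, Pi.smul_apply, smul_eq_mul]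
  filter_upwards [condLExp_smul' (mΩ := 𝒜) (P := μ) (fun y => ENNReal.ofReal (g y))
      (ENNReal.ofReal_ne_top (r := c)),
    condLExp_smul' (mΩ := 𝒜) (P := μ) (fun y => ENNReal.ofReal (-g y))
      (ENNReal.ofReal_ne_top (r := c))] with x h1 h2
  simp only [condExpReal, e1, e2, h1, h2, Pi.smul_apply, smul_eq_mul, ENNReal.toReal_mul,
    ENNReal.toReal_ofReal hc]
  ring

lemma condExpReal_const_mul (g : X → ℝ) (c : ℝ) :
    condExpReal 𝒜 μ (fun y => c * g y) =ᵐ[μ] fun x => c * condExpReal 𝒜 μ g x := by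
  rcases le_total 0 c with hc | hc
  · exact condExpReal_const_mul_of_nonneg g hc
  · have e : (fun y => c * g y) = fun y => -(-c * g y) := by
      funext y
      ring
    filter_upwards [condExpReal_const_mul_of_nonneg (𝒜 := 𝒜) (μ := μ) g (neg_nonneg.2 hc)]
      with x hx
    rw [e, condExpReal_neg, hx]
    ring

variable (𝒜) (μ) in
/-- The space `D(E)` of conditionable functions: `E(|f|)` is finite almost everywhere. -/
def conditionable : Submodule ℂ (X →ₘ[μ] ℂ) where
  carrier := {f | ∀ᵐ x ∂μ, condLExp 𝒜 μ (fun y => ‖f y‖ₑ) x < ∞}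
  zero_mem' := by
    refine condLExp_lt_top_of_le ?_ (condLExp_const_lt_top (c := 0) (by simp))
    filter_upwards [AEEqFun.coeFn_zero (μ := μ) (β := ℂ) (α := X)] with x hx
    simp [hx]
  add_mem' := by
    intro f g hf hg
    refine condLExp_lt_top_of_le ?_ (condLExp_add_lt_top f.aemeasurable.enorm hf hg)
    filter_upwards [AEEqFun.coeFn_add f g] with x hx
    rw [hx]
    exact enorm_add_le _ _
  smul_mem' := by
    intro c f hf
    refine condLExp_lt_top_of_le ?_ (condLExp_smul_lt_top (c := ‖c‖ₑ) (by simp) hf)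
    filter_upwards [AEEqFun.coeFn_smul c f] with x hx
    simp [hx, enorm_mul]

lemma finCond_re {f : X →ₘ[μ] ℂ} (hf : f ∈ conditionable 𝒜 μ) :
    FinCond 𝒜 μ (fun y => (f y).re) := by
  refine ⟨Complex.measurable_re.comp_aemeasurable f.aemeasurable, ?_⟩
  refine condLExp_lt_top_of_le (ae_of_all _ fun y => ?_) hf
  rw [← ofReal_norm]
  exact ENNReal.ofReal_le_ofReal (Complex.abs_re_le_norm _)

lemma finCond_im {f : X →ₘ[μ] ℂ} (hf : f ∈ conditionable 𝒜 μ) :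
    FinCond 𝒜 μ (fun y => (f y).im) := by
  refine ⟨Complex.measurable_im.comp_aemeasurable f.aemeasurable, ?_⟩
  refine condLExp_lt_top_of_le (ae_of_all _ fun y => ?_) hf
  rw [← ofReal_norm]
  exact ENNReal.ofReal_le_ofReal (Complex.abs_im_le_norm _)

lemma coeFn_condE (f : X →ₘ[μ] ℂ) : condE 𝒜 f =ᵐ[μ]
    fun x => (condExpReal 𝒜 μ (fun y => (f y).re) x : ℂ)
      + (condExpReal 𝒜 μ (fun y => (f y).im) x : ℂ) * Complex.I :=
  AEEqFun.coeFn_mk _ _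

lemma condE_add {f g : X →ₘ[μ] ℂ} (hf : f ∈ conditionable 𝒜 μ) (hg : g ∈ conditionable 𝒜 μ) :
    condE 𝒜 (f + g) = condE 𝒜 f + condE 𝒜 g := by
  refine AEEqFun.ext ?_
  have r : (fun y => ((f + g : X →ₘ[μ] ℂ) y).re) =ᵐ[μ] fun y => (f y).re + (g y).re := by
    filter_upwards [AEEqFun.coeFn_add f g] with y hy
    simp [hy]
  have i : (fun y => ((f + g : X →ₘ[μ] ℂ) y).im) =ᵐ[μ] fun y => (f y).im + (g y).im := by
    filter_upwards [AEEqFun.coeFn_add f g] with y hy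
    simp [hy]
  filter_upwards [coeFn_condE (𝒜 := 𝒜) (f + g), coeFn_condE (𝒜 := 𝒜) f, coeFn_condE (𝒜 := 𝒜) g,
    AEEqFun.coeFn_add (condE 𝒜 f) (condE 𝒜 g),
    (condExpReal_congr (𝒜 := 𝒜) r).trans (condExpReal_add (finCond_re hf) (finCond_re hg)),
    (condExpReal_congr (𝒜 := 𝒜) i).trans (condExpReal_add (finCond_im hf) (finCond_im hg))]
    with x h1 h2 h3 h4 h5 h6
  rw [h1, h4, Pi.add_apply, h2, h3, h5, h6]
  push_cast
  ring

lemma condE_smul (c : ℂ) {f : X →ₘ[μ] ℂ} (hf : f ∈ conditionable 𝒜 μ) :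
    condE 𝒜 (c • f) = c • condE 𝒜 f := by
  refine AEEqFun.ext ?_
  have r : (fun y => ((c • f : X →ₘ[μ] ℂ) y).re) =ᵐ[μ]
      fun y => c.re * (f y).re + (-c.im) * (f y).im := by
    filter_upwards [AEEqFun.coeFn_smul c f] with y hy
    simp [hy, sub_eq_add_neg]
  have i : (fun y => ((c • f : X →ₘ[μ] ℂ) y).im) =ᵐ[μ]
      fun y => c.re * (f y).im + c.im * (f y).re := by
    filter_upwards [AEEqFun.coeFn_smul c f] with y hy
    simp [hy]
  filter_upwards [coeFn_condE (𝒜 := 𝒜) (c • f), coeFn_condE (𝒜 := 𝒜) f,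
    AEEqFun.coeFn_smul c (condE 𝒜 f),
    (condExpReal_congr (𝒜 := 𝒜) r).trans (condExpReal_add ((finCond_re hf).const_mul c.re)
      ((finCond_im hf).const_mul (-c.im))),
    (condExpReal_congr (𝒜 := 𝒜) i).trans (condExpReal_add ((finCond_im hf).const_mul c.re)
      ((finCond_re hf).const_mul c.im)),
    condExpReal_const_mul (𝒜 := 𝒜) (μ := μ) (fun y => (f y).re) c.re,
    condExpReal_const_mul (𝒜 := 𝒜) (μ := μ) (fun y => (f y).im) (-c.im),
    condExpReal_const_mul (𝒜 := 𝒜) (μ := μ) (fun y => (f y).im) c.re,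
    condExpReal_const_mul (𝒜 := 𝒜) (μ := μ) (fun y => (f y).re) c.im]
    with x h1 h2 h3 h4 h5 a1 a2 a3 a4
  rw [h1, h3, Pi.smul_apply, h2, h4, h5, a1, a2, a3, a4, smul_eq_mul]
  refine Complex.ext ?_ ?_
  all_goals simp
  ring

/-- `L^Φ ⊆ D(E)`. -/
lemma orliczSpace_le_conditionable (Φ : YoungFunction) :
    orliczSpace μ Φ ≤ conditionable 𝒜 μ := by
  rintro f ⟨ε, hε, hf⟩
  obtain ⟨x₀, hx₀, hx₁⟩ : ∃ x₀ : ℝ, 0 < x₀ ∧ 1 ≤ Φ x₀ :=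
    ((Filter.eventually_gt_atTop 0).and (Φ.tendsto'.eventually_ge_atTop 1)).exists
  -- an affine minorant: `t ≤ x₀ + x₀ Φ(t)`
  have key : ∀ t : ℝ, 0 ≤ t → t ≤ x₀ + x₀ * Φ t := fun t ht => by
    rcases le_total t x₀ with h | h
    · nlinarith [Φ.nonneg' t]
    · have ht0 : 0 < t := hx₀.trans_le h
      have := Φ.scale (div_nonneg hx₀.le ht) ((div_le_one ht0).2 h) t
      rw [div_mul_cancel₀ _ ht0.ne', div_mul_eq_mul_div, le_div_iff₀ ht0] at this
      nlinarith
  have hmod : ∀ᵐ x ∂μ, condLExp 𝒜 μ (fun x => ENNReal.ofReal (Φ (ε * ‖f x‖))) x < ∞ :=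
    condLExp_lt_top (P := μ) (mΩ := 𝒜) hf.ne
  have hsum := condLExp_add_lt_top (𝒜 := 𝒜) (μ := μ) (p := fun _ => ENNReal.ofReal (ε⁻¹ * x₀))
    aemeasurable_const (condLExp_const_lt_top ENNReal.ofReal_ne_top)
    (condLExp_smul_lt_top (c := ENNReal.ofReal (ε⁻¹ * x₀)) ENNReal.ofReal_ne_top hmod)
  refine condLExp_lt_top_of_le (ae_of_all _ fun x => ?_) hsum
  simp only [Pi.add_apply, Pi.smul_apply, smul_eq_mul]
  rw [← ENNReal.ofReal_mul (by positivity),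
    ← ENNReal.ofReal_add (by positivity) (mul_nonneg (by positivity) (Φ.nonneg' _)),
    ← ofReal_norm]
  refine ENNReal.ofReal_le_ofReal ?_
  have h := key (ε * ‖f x‖) (by positivity)
  calc ‖f x‖ = ε⁻¹ * (ε * ‖f x‖) := by field_simp
    _ ≤ ε⁻¹ * (x₀ + x₀ * Φ (ε * ‖f x‖)) := mul_le_mul_of_nonneg_left h (by positivity)
    _ = _ := by ring

/-! ### Lambert multipliers -/

variable (𝒜)

/-- The product `f * g = f E(g) + g E(f) - E(f) E(g)`. -/
def starMul (f g : X →ₘ[μ] ℂ) : X →ₘ[μ] ℂ :=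
  f * condE 𝒜 g + g * condE 𝒜 f - condE 𝒜 f * condE 𝒜 g

/-- `u` is a Lambert multiplier from `L^Φ` to `L^Ψ`: `u ∈ D(E)` and `u * f ∈ L^Ψ` for every
`f ∈ L^Φ`. -/
def IsLambertMultiplier (Φ Ψ : YoungFunction) (u : X →ₘ[μ] ℂ) : Prop :=
  u ∈ conditionable 𝒜 μ ∧ ∀ f ∈ orliczSpace μ Φ, starMul 𝒜 u f ∈ orliczSpace μ Ψ

lemma aeeq_mul_add (f g h : X →ₘ[μ] ℂ) : f * (g + h) = f * g + f * h := by
  refine AEEqFun.ext ?_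
  filter_upwards [AEEqFun.coeFn_mul f (g + h), AEEqFun.coeFn_add g h,
    AEEqFun.coeFn_add (f * g) (f * h), AEEqFun.coeFn_mul f g, AEEqFun.coeFn_mul f h]
    with x h1 h2 h3 h4 h5
  simp only [h1, h2, h3, h4, h5, Pi.mul_apply, Pi.add_apply]
  ring

lemma aeeq_mul_smul (c : ℂ) (f g : X →ₘ[μ] ℂ) : f * (c • g) = c • (f * g) := by
  refine AEEqFun.ext ?_
  filter_upwards [AEEqFun.coeFn_mul f (c • g), AEEqFun.coeFn_smul c g,
    AEEqFun.coeFn_smul c (f * g), AEEqFun.coeFn_mul f g]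
    with x h1 h2 h3 h4
  simp only [h1, h2, h3, h4, Pi.mul_apply, Pi.smul_apply, smul_eq_mul]
  ring

variable {𝒜}

/-- The `*`-multiplication operator `T_u : L^Φ → L^Ψ`, `T_u f = u * f`, of a Lambert multiplier. -/
def starMulOp {Φ Ψ : YoungFunction} {u : X →ₘ[μ] ℂ} (hu : IsLambertMultiplier 𝒜 Φ Ψ u) :
    orliczSpace μ Φ →ₗ[ℂ] orliczSpace μ Ψ where
  toFun f := ⟨starMul 𝒜 u f, hu.2 f f.2⟩
  map_add' f g := by
    refine Subtype.ext ?_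
    have hf := orliczSpace_le_conditionable (𝒜 := 𝒜) Φ f.2
    have hg := orliczSpace_le_conditionable (𝒜 := 𝒜) Φ g.2
    simp only [starMul, Submodule.coe_add, condE_add hf hg, aeeq_mul_add,
      mul_comm _ (condE 𝒜 u)]
    abel
  map_smul' c f := by
    refine Subtype.ext ?_
    have hf := orliczSpace_le_conditionable (𝒜 := 𝒜) Φ f.2
    simp only [starMul, Submodule.coe_smul, condE_smul c hf, aeeq_mul_smul,
      mul_comm _ (condE 𝒜 u), smul_add, smul_sub, RingHom.id_apply]

end CondExp

/-! ### Fredholm operators and non-atomic σ-algebras -/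

/-- An operator between normed spaces is Fredholm if its range is closed, its kernel has finite
dimension and its range has finite codimension. -/
structure IsFredholmOp {V W : Type*} [NormedAddCommGroup V] [NormedSpace ℂ V]
    [NormedAddCommGroup W] [NormedSpace ℂ W] (T : V →ₗ[ℂ] W) : Prop where
  isClosed_range : IsClosed (LinearMap.range T : Set W)
  finite_ker : FiniteDimensional ℂ (LinearMap.ker T)
  finite_coker : FiniteDimensional ℂ (W ⧸ LinearMap.range T)

/-- `A` is an atom of the measure space `(X, 𝒜, ν)`. -/
def IsMeasureAtom {𝒜 : MeasurableSpace X} (ν : Measure X) (A : Set X) : Prop :=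
  MeasurableSet A ∧ 0 < ν A ∧ ∀ F : Set X, MeasurableSet F → F ⊆ A → ν F = 0 ∨ ν F = ν A

/-- The measure space `(X, 𝒜, ν)` is non-atomic: it has no atoms. -/
def IsNonAtomic {𝒜 : MeasurableSpace X} (ν : Measure X) : Prop :=
  ∀ A : Set X, ¬ IsMeasureAtom ν A

end LambertOrlicz

end

/-!
The operator `T_u` is linked to multiplication by `E(u)` by the identity `E(u * g) = E(u) E(g)`
(`condE_starMul`), a consequence of the pull-out property of `E` (`condE_mul`). Hence an
`𝒜`-measurable function in the range of `T_u` has the form `E(u) E(g)` with `g ∈ L^Φ`, and it is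
enough to find infinitely many `𝒜`-measurable functions in `L^Φ` no nontrivial combination of which
has this form: the range then has infinite codimension.

If `E(u)` is not bounded away from zero, then all the sets `{|E(u)| < 4⁻ⁿ}` have positive measure,
and since `𝒜` is non-atomic they contain disjoint sets `B n ∈ 𝒜` of finite positive measure
(`IsNonAtomic.exists_disjoint_subsets`). Take `a n > 0` with `Φ (a n) μ (B n) = 2⁻ⁿ`. Any function
with the values `a n` on some of the `B n`, and zero elsewhere, is in `L^Φ`. If it is `E(u) E(g)`
up to a factor `κ > 0` in absolute value, then `|E(g)| ≥ κ 4ⁿ a n` on those `B n`, and by convexity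
the modular of `c g` over `B n` is at least of order `c κ 4ⁿ 2⁻ⁿ = c κ 2ⁿ`
(`two_pow_le_of_le_norm_condE`). For infinitely many `n` this is impossible when `g ∈ L^Φ`. The
splitting of `ℕ` into infinitely many infinite sets of indices `n` gives the required functions
(`exists_block_functions`).

The estimate of the modular needs no conditional Jensen inequality: an affine minorant of `Φ` and
the bound `∫ |E(g)| ≤ 2 ∫ |g|` over sets of `𝒜` are enough.
-/

open MeasureTheory
open scoped ENNReal

namespace LambertOrlicz

/-! ### Conditional expectation of products -/

section PullOut

variable {X : Type*} {𝒜 mX : MeasurableSpace X} {μ : Measure X}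

/-- The pull-out property of the conditional expectation of functions with values in `[0, ∞]`. It
holds because `p dμ` and `E(p) dμ` are the same measure on `𝒜`. -/
lemma condLExp_mul_left (h𝒜 : 𝒜 ≤ mX) [SigmaFinite (μ.trim h𝒜)] {h p : X → ℝ≥0∞}
    (hh : Measurable[𝒜] h) (hp : AEMeasurable p μ) :
    condLExp 𝒜 μ (fun y => h y * p y) =ᵐ[μ] fun x => h x * condLExp 𝒜 μ p x := by
  refine (ae_eq_condLExp h𝒜 μ _ (hh.mul (measurable_condLExp _ _ _)) fun s hs => ?_).symm
  have key : (μ.withDensity (condLExp 𝒜 μ p)).trim h𝒜 = (μ.withDensity p).trim h𝒜 := by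
    refine @Measure.ext _ 𝒜 _ _ fun t ht => ?_
    rw [trim_measurableSet_eq h𝒜 ht, trim_measurableSet_eq h𝒜 ht, withDensity_apply _ (h𝒜 t ht),
      withDensity_apply _ (h𝒜 t ht), setLIntegral_condLExp h𝒜 μ p ht]
  have hm : Measurable[𝒜] (s.indicator h) := hh.indicator hs
  have aux : ∀ q : X → ℝ≥0∞, AEMeasurable q μ →
      ∫⁻ x in s, h x * q x ∂μ = ∫⁻ x, s.indicator h x ∂((μ.withDensity q).trim h𝒜) := by
    intro q hq
    rw [lintegral_trim h𝒜 hm,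
      lintegral_withDensity_eq_lintegral_mul₀ hq (hm.mono h𝒜 le_rfl).aemeasurable,
      ← lintegral_indicator (h𝒜 s hs)]
    refine lintegral_congr fun x => ?_
    by_cases hx : x ∈ s <;> simp [hx, mul_comm]
  simp only [Pi.mul_apply]
  rw [aux _ (measurable_condLExp' 𝒜 μ p).aemeasurable, aux p hp, key]

lemma FinCond.mul_left (h𝒜 : 𝒜 ≤ mX) [SigmaFinite (μ.trim h𝒜)] {h g : X → ℝ}
    (hh : Measurable[𝒜] h) (hg : FinCond 𝒜 μ g) : FinCond 𝒜 μ (fun y => h y * g y) := by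
  refine ⟨(hh.mono h𝒜 le_rfl).aemeasurable.mul hg.1, ?_⟩
  have e : (fun y => ENNReal.ofReal |h y * g y|)
      = fun y => ENNReal.ofReal |h y| * ENNReal.ofReal |g y| := by
    funext y
    rw [abs_mul, ENNReal.ofReal_mul (abs_nonneg _)]
  have hm : Measurable[𝒜] fun y => ENNReal.ofReal |h y| :=
    ENNReal.measurable_ofReal.comp (measurable_abs.comp hh)
  rw [e]
  filter_upwards [condLExp_mul_left h𝒜 hm
    (show AEMeasurable (fun y => ENNReal.ofReal |g y|) μ from
      (measurable_abs.comp_aemeasurable hg.1).ennreal_ofReal), hg.2] with x h1 h2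
  rw [h1]
  exact ENNReal.mul_lt_top ENNReal.ofReal_lt_top h2

lemma condExpReal_mul_left (h𝒜 : 𝒜 ≤ mX) [SigmaFinite (μ.trim h𝒜)] {h g : X → ℝ}
    (hh : Measurable[𝒜] h) (hg : FinCond 𝒜 μ g) :
    condExpReal 𝒜 μ (fun y => h y * g y) =ᵐ[μ] fun x => h x * condExpReal 𝒜 μ g x := by
  -- `h⁺ g` and `h⁻ g` are handled separately
  have nonneg_case : ∀ k : X → ℝ, Measurable[𝒜] k → (∀ y, 0 ≤ k y) →
      condExpReal 𝒜 μ (fun y => k y * g y) =ᵐ[μ] fun x => k x * condExpReal 𝒜 μ g x := by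
    intro k hk hk0
    have hm : Measurable[𝒜] fun y => ENNReal.ofReal (k y) := ENNReal.measurable_ofReal.comp hk
    filter_upwards [condLExp_mul_left h𝒜 hm hg.1.ennreal_ofReal,
      condLExp_mul_left h𝒜 hm hg.1.neg.ennreal_ofReal] with x h1 h2
    simp only [Pi.neg_apply] at h2
    simp only [condExpReal, ← mul_neg, ENNReal.ofReal_mul (hk0 _), h1, h2, ENNReal.toReal_mul,
      ENNReal.toReal_ofReal (hk0 _)]
    ring
  have hpos : Measurable[𝒜] fun y => max (h y) 0 := hh.max measurable_const
  have hneg : Measurable[𝒜] fun y => max (-h y) 0 := (measurable_neg.comp hh).max measurable_const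
  have hmax : ∀ t : ℝ, max t 0 - max (-t) 0 = t := fun t => by
    rcases le_total 0 t with a | a
    · rw [max_eq_left a, max_eq_right (neg_nonpos.2 a), sub_zero]
    · rw [max_eq_right a, max_eq_left (neg_nonneg.2 a), zero_sub, neg_neg]
  have e : (fun y => h y * g y) = fun y => max (h y) 0 * g y + -(max (-h y) 0 * g y) := by
    funext y
    linear_combination (-g y) * hmax (h y)
  rw [e]
  filter_upwards [nonneg_case _ hpos fun _ => le_max_right _ _,
    nonneg_case _ hneg fun _ => le_max_right _ _,
    condExpReal_add (hg.mul_left h𝒜 hpos) (hg.mul_left h𝒜 hneg).neg] with x h1 h2 h3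
  rw [h3, condExpReal_neg, h1, h2]
  linear_combination (condExpReal 𝒜 μ g x) * hmax (h x)

lemma condExpReal_of_measurable (h𝒜 : 𝒜 ≤ mX) [SigmaFinite (μ.trim h𝒜)] {h : X → ℝ}
    (hh : Measurable[𝒜] h) : condExpReal 𝒜 μ h = h := by
  funext x
  have h1 : Measurable[𝒜] fun y => ENNReal.ofReal (h y) := ENNReal.measurable_ofReal.comp hh
  have h2 : Measurable[𝒜] fun y => ENNReal.ofReal (-h y) :=
    ENNReal.measurable_ofReal.comp (measurable_neg.comp hh)
  rw [condExpReal, condLExp_eq_self h𝒜 μ h1, condLExp_eq_self h𝒜 μ h2, ENNReal.toReal_ofReal',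
    ENNReal.toReal_ofReal']
  rcases le_total 0 (h x) with a | a
  · rw [max_eq_left a, max_eq_right (neg_nonpos.2 a), sub_zero]
  · rw [max_eq_right a, max_eq_left (neg_nonneg.2 a), zero_sub, neg_neg]

lemma aestronglyMeasurable_condE (f : X →ₘ[μ] ℂ) :
    AEStronglyMeasurable[𝒜] (condE 𝒜 f) μ := by
  have hm : ∀ g : X → ℝ, Measurable[𝒜] (condExpReal 𝒜 μ g) := fun g =>
    ((measurable_condLExp 𝒜 μ _).ennreal_toReal).sub (measurable_condLExp 𝒜 μ _).ennreal_toReal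
  refine ⟨_, Measurable.stronglyMeasurable ?_, coeFn_condE f⟩
  exact (Complex.measurable_ofReal.comp (hm _)).add
    ((Complex.measurable_ofReal.comp (hm _)).mul_const _)

lemma mul_mem_conditionable (h𝒜 : 𝒜 ≤ mX) [SigmaFinite (μ.trim h𝒜)] {k f : X →ₘ[μ] ℂ}
    (hk : AEStronglyMeasurable[𝒜] k μ) (hf : f ∈ conditionable 𝒜 μ) :
    f * k ∈ conditionable 𝒜 μ := by
  obtain ⟨h, hh, hkh⟩ := hk
  have hm : Measurable[𝒜] fun y => ‖h y‖ₑ := measurable_enorm.comp hh.measurable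
  have e : (fun y => ‖(f * k) y‖ₑ) =ᵐ[μ] fun y => ‖h y‖ₑ * ‖f y‖ₑ := by
    filter_upwards [hkh, AEEqFun.coeFn_mul f k] with y h1 h2
    rw [h2, Pi.mul_apply, h1, enorm_mul, mul_comm]
  change ∀ᵐ x ∂μ, condLExp 𝒜 μ (fun y => ‖(f * k) y‖ₑ) x < ∞
  filter_upwards [condLExp_congr_ae (mΩ := 𝒜) e, condLExp_mul_left h𝒜 hm f.aemeasurable.enorm, hf]
    with x h1 h2 h3
  rw [h1, h2]
  exact ENNReal.mul_lt_top (by simp) h3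

/-- The pull-out property of the conditional expectation on `D(E)`. -/
lemma condE_mul (h𝒜 : 𝒜 ≤ mX) [SigmaFinite (μ.trim h𝒜)] {k f : X →ₘ[μ] ℂ}
    (hk : AEStronglyMeasurable[𝒜] k μ) (hf : f ∈ conditionable 𝒜 μ) :
    condE 𝒜 (f * k) = condE 𝒜 f * k := by
  obtain ⟨h, hh, hkh⟩ := hk
  have hre : Measurable[𝒜] fun y => (h y).re := Complex.measurable_re.comp hh.measurable
  have him : Measurable[𝒜] fun y => (h y).im := Complex.measurable_im.comp hh.measurable
  have hnim : Measurable[𝒜] fun y => -(h y).im := measurable_neg.comp him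
  have r : (fun y => ((f * k : X →ₘ[μ] ℂ) y).re) =ᵐ[μ]
      fun y => (h y).re * (f y).re + -(h y).im * (f y).im := by
    filter_upwards [hkh, AEEqFun.coeFn_mul f k] with y h1 h2
    rw [h2, Pi.mul_apply, h1, Complex.mul_re]
    ring
  have i : (fun y => ((f * k : X →ₘ[μ] ℂ) y).im) =ᵐ[μ]
      fun y => (h y).re * (f y).im + (h y).im * (f y).re := by
    filter_upwards [hkh, AEEqFun.coeFn_mul f k] with y h1 h2
    rw [h2, Pi.mul_apply, h1, Complex.mul_im]
    ring
  have fr := finCond_re hf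
  have fi := finCond_im hf
  refine AEEqFun.ext ?_
  filter_upwards [hkh, coeFn_condE (𝒜 := 𝒜) (f * k), coeFn_condE (𝒜 := 𝒜) f,
    AEEqFun.coeFn_mul (condE 𝒜 f) k,
    (condExpReal_congr (𝒜 := 𝒜) r).trans
      (condExpReal_add (fr.mul_left h𝒜 hre) (fi.mul_left h𝒜 hnim)),
    (condExpReal_congr (𝒜 := 𝒜) i).trans
      (condExpReal_add (fi.mul_left h𝒜 hre) (fr.mul_left h𝒜 him)),
    condExpReal_mul_left h𝒜 hre fr, condExpReal_mul_left h𝒜 hnim fi,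
    condExpReal_mul_left h𝒜 hre fi, condExpReal_mul_left h𝒜 him fr]
    with x hx h1 h2 h3 h4 h5 a1 a2 a3 a4
  rw [h1, h3, Pi.mul_apply, h2, hx, h4, h5, a1, a2, a3, a4]
  refine Complex.ext ?_ ?_
  all_goals simp
  all_goals ring

lemma condE_of_aestronglyMeasurable (h𝒜 : 𝒜 ≤ mX) [SigmaFinite (μ.trim h𝒜)] {k : X →ₘ[μ] ℂ}
    (hk : AEStronglyMeasurable[𝒜] k μ) : condE 𝒜 k = k := by
  obtain ⟨h, hh, hkh⟩ := hk
  have hre : Measurable[𝒜] fun y => (h y).re := Complex.measurable_re.comp hh.measurable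
  have him : Measurable[𝒜] fun y => (h y).im := Complex.measurable_im.comp hh.measurable
  have r : (fun y => (k y).re) =ᵐ[μ] fun y => (h y).re := by
    filter_upwards [hkh] with y hy
    rw [hy]
  have i : (fun y => (k y).im) =ᵐ[μ] fun y => (h y).im := by
    filter_upwards [hkh] with y hy
    rw [hy]
  refine AEEqFun.ext ?_
  filter_upwards [hkh, coeFn_condE (𝒜 := 𝒜) k, condExpReal_congr (𝒜 := 𝒜) r,
    condExpReal_congr (𝒜 := 𝒜) i] with x h0 h1 h2 h3
  rw [h1, h2, h3, condExpReal_of_measurable h𝒜 hre, condExpReal_of_measurable h𝒜 him, h0,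
    Complex.re_add_im]

lemma condE_mem_conditionable (h𝒜 : 𝒜 ≤ mX) [SigmaFinite (μ.trim h𝒜)] (f : X →ₘ[μ] ℂ) :
    condE 𝒜 f ∈ conditionable 𝒜 μ := by
  obtain ⟨h, hh, hkh⟩ := aestronglyMeasurable_condE (𝒜 := 𝒜) f
  have hm : Measurable[𝒜] fun y => ‖h y‖ₑ := measurable_enorm.comp hh.measurable
  have e : (fun y => ‖condE 𝒜 f y‖ₑ) =ᵐ[μ] fun y => ‖h y‖ₑ := by
    filter_upwards [hkh] with y h1
    rw [h1]
  change ∀ᵐ x ∂μ, condLExp 𝒜 μ (fun y => ‖condE 𝒜 f y‖ₑ) x < ∞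
  filter_upwards [condLExp_congr_ae (mΩ := 𝒜) e] with x h1
  rw [h1, condLExp_eq_self h𝒜 μ hm]
  exact enorm_lt_top

/-- The conditional expectation is multiplicative for the product `f * g`. -/
lemma condE_starMul (h𝒜 : 𝒜 ≤ mX) [SigmaFinite (μ.trim h𝒜)] {f g : X →ₘ[μ] ℂ}
    (hf : f ∈ conditionable 𝒜 μ) (hg : g ∈ conditionable 𝒜 μ) :
    condE 𝒜 (starMul 𝒜 f g) = condE 𝒜 f * condE 𝒜 g := by
  have mf := aestronglyMeasurable_condE (𝒜 := 𝒜) f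
  have mg := aestronglyMeasurable_condE (𝒜 := 𝒜) g
  have h1 := mul_mem_conditionable h𝒜 mg hf
  have h2 := mul_mem_conditionable h𝒜 mf hg
  have h3 := mul_mem_conditionable h𝒜 mg (condE_mem_conditionable h𝒜 f)
  have e : starMul 𝒜 f g = f * condE 𝒜 g + g * condE 𝒜 f + (-1 : ℂ) • (condE 𝒜 f * condE 𝒜 g) := by
    rw [starMul, neg_one_smul ℂ (condE 𝒜 f * condE 𝒜 g), sub_eq_add_neg]
  rw [e, condE_add (add_mem h1 h2) (Submodule.smul_mem _ _ h3), condE_add h1 h2, condE_smul _ h3,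
    condE_mul h𝒜 mg hf, condE_mul h𝒜 mf hg, condE_mul h𝒜 mg (condE_mem_conditionable h𝒜 f),
    condE_of_aestronglyMeasurable h𝒜 mf, neg_one_smul ℂ (condE 𝒜 f * condE 𝒜 g),
    mul_comm (condE 𝒜 g)]
  abel

/-- A crude form of `|E(f)| ≤ E(|f|)`: the factor `2` comes from treating the real and the
imaginary part separately. -/
lemma enorm_condE_le (f : X →ₘ[μ] ℂ) :
    ∀ᵐ x ∂μ, ‖condE 𝒜 f x‖ₑ ≤ 2 * condLExp 𝒜 μ (fun y => ‖f y‖ₑ) x := by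
  have part : ∀ g : X → ℝ, (∀ y, |g y| ≤ ‖f y‖) →
      ∀ᵐ x ∂μ, condLExp 𝒜 μ (fun y => ‖f y‖ₑ) x ≠ ∞ →
        |condExpReal 𝒜 μ g x| ≤ (condLExp 𝒜 μ (fun y => ‖f y‖ₑ) x).toReal := by
    intro g hg
    have h1 : (fun y => ENNReal.ofReal (g y)) ≤ᵐ[μ] fun y => ‖f y‖ₑ := ae_of_all _ fun y => by
      simp only [← ofReal_norm]
      exact ENNReal.ofReal_le_ofReal ((le_abs_self _).trans (hg y))
    have h2 : (fun y => ENNReal.ofReal (-g y)) ≤ᵐ[μ] fun y => ‖f y‖ₑ := ae_of_all _ fun y => by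
      simp only [← ofReal_norm]
      exact ENNReal.ofReal_le_ofReal ((neg_le_abs _).trans (hg y))
    filter_upwards [condLExp_mono (mΩ := 𝒜) h1, condLExp_mono (mΩ := 𝒜) h2] with x a b hx
    have a' := ENNReal.toReal_mono hx a
    have b' := ENNReal.toReal_mono hx b
    rw [condExpReal, abs_sub_le_iff]
    constructor <;> linarith [ENNReal.toReal_nonneg
      (a := condLExp 𝒜 μ (fun y => ENNReal.ofReal (g y)) x), ENNReal.toReal_nonneg
      (a := condLExp 𝒜 μ (fun y => ENNReal.ofReal (-g y)) x)]
  filter_upwards [coeFn_condE (𝒜 := 𝒜) f, part _ fun y => Complex.abs_re_le_norm (f y),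
    part _ fun y => Complex.abs_im_le_norm (f y)] with x h0 h1 h2
  by_cases hx : condLExp 𝒜 μ (fun y => ‖f y‖ₑ) x = ∞
  · rw [hx, ENNReal.mul_top (by simp)]
    exact le_top
  have h3 : ‖condE 𝒜 f x‖ ≤ 2 * (condLExp 𝒜 μ (fun y => ‖f y‖ₑ) x).toReal := by
    rw [h0]
    refine (norm_add_le _ _).trans ?_
    rw [norm_mul, Complex.norm_I, mul_one, Complex.norm_real, Complex.norm_real, Real.norm_eq_abs,
      Real.norm_eq_abs]
    linarith [h1 hx, h2 hx]
  rw [← ofReal_norm]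
  refine (ENNReal.ofReal_le_ofReal h3).trans ?_
  rw [ENNReal.ofReal_mul zero_le_two, ENNReal.ofReal_toReal hx, ENNReal.ofReal_ofNat]

lemma setLIntegral_enorm_condE_le (h𝒜 : 𝒜 ≤ mX) [SigmaFinite (μ.trim h𝒜)] (f : X →ₘ[μ] ℂ)
    {s : Set X} (hs : MeasurableSet[𝒜] s) :
    ∫⁻ x in s, ‖condE 𝒜 f x‖ₑ ∂μ ≤ 2 * ∫⁻ x in s, ‖f x‖ₑ ∂μ := by
  rw [← setLIntegral_condLExp h𝒜 μ (fun x => ‖f x‖ₑ) hs, ← lintegral_const_mul _ (measurable_condLExp' 𝒜 μ _)]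
  exact lintegral_mono_ae (ae_restrict_of_ae (enorm_condE_le f))

end PullOut

/-! ### Non-atomic measures -/

section NonAtomic

variable {X : Type*} {mX : MeasurableSpace X} {ν : Measure X}

/-- In a non-atomic space, every set of positive measure contains sets of arbitrarily small
positive measure. -/
lemma IsNonAtomic.exists_subset_measure_lt [SigmaFinite ν] (hν : IsNonAtomic ν) {A : Set X}
    (hA : MeasurableSet A) (hA0 : 0 < ν A) {ε : ℝ≥0∞} (hε : ε ≠ 0) :
    ∃ F ⊆ A, MeasurableSet F ∧ 0 < ν F ∧ ν F < ε := by
  obtain ⟨A', hA', hAA', hA'0, hA'top⟩ := Measure.exists_subset_measure_lt_top hA hA0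
  have halve : ∀ B : Set X, MeasurableSet B → 0 < ν B → ν B < ∞ →
      ∃ F ⊆ B, MeasurableSet F ∧ 0 < ν F ∧ 2 * ν F ≤ ν B := by
    intro B hB hB0 hBtop
    obtain ⟨F, hF, hFB, hF0, hF1⟩ : ∃ F, MeasurableSet F ∧ F ⊆ B ∧ ν F ≠ 0 ∧ ν F ≠ ν B := by
      by_contra! hcon
      exact hν B ⟨hB, hB0, fun F hF hFB => or_iff_not_imp_left.2 (hcon F hF hFB)⟩
    have hlt : ν F < ν B := lt_of_le_of_ne (measure_mono hFB) hF1
    have hsum : ν F + ν (B \ F) = ν B := by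
      rw [← measure_inter_add_sdiff B hF, Set.inter_eq_self_of_subset_right hFB]
    rcases le_total (ν F) (ν (B \ F)) with h | h
    · refine ⟨F, hFB, hF, hF0.bot_lt, ?_⟩
      rw [two_mul, ← hsum]
      gcongr
    · refine ⟨B \ F, Set.sdiff_subset, hB.diff hF, ?_, ?_⟩
      · refine pos_iff_ne_zero.2 fun h0 => ?_
        rw [h0, add_zero] at hsum
        exact hF1 hsum
      · rw [two_mul, ← hsum]
        gcongr
  have iter : ∀ n : ℕ, ∃ F ⊆ A', MeasurableSet F ∧ 0 < ν F ∧ 2 ^ n * ν F ≤ ν A' := by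
    intro n
    induction n with
    | zero => exact ⟨A', subset_rfl, hA', hA'0, by simp⟩
    | succ n ih =>
      obtain ⟨B, hBA, hB, hB0, hBn⟩ := ih
      obtain ⟨F, hFB, hF, hF0, hF2⟩ := halve B hB hB0 ((measure_mono hBA).trans_lt hA'top)
      refine ⟨F, hFB.trans hBA, hF, hF0, ?_⟩
      calc 2 ^ (n + 1) * ν F = 2 ^ n * (2 * ν F) := by ring
        _ ≤ 2 ^ n * ν B := by gcongr
        _ ≤ ν A' := hBn
  obtain ⟨n, hn⟩ : ∃ n : ℕ, ν A' / ε < 2 ^ n := by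
    obtain ⟨n, hn⟩ := ENNReal.exists_nat_gt (ENNReal.div_lt_top hA'top.ne hε).ne
    refine ⟨n, hn.trans ?_⟩
    exact_mod_cast Nat.lt_two_pow_self
  obtain ⟨F, hFA, hF, hF0, hFn⟩ := iter n
  refine ⟨F, hFA.trans hAA', hF, hF0, ?_⟩
  by_contra! hcon
  have : ν A' < 2 ^ n * ε := by
    rcases eq_or_ne ε ∞ with rfl | hε'
    · rw [ENNReal.mul_top (by positivity)]
      exact hA'top
    · exact (ENNReal.div_lt_iff (Or.inl hε) (Or.inl hε')).1 hn
  exact absurd (hFn.trans_lt this) (not_lt.2 (by gcongr))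

/-- In a non-atomic space, sets `D 0, D 1, …` of positive measure contain disjoint sets of finite
positive measure: the subsets `C n ⊆ D n` are taken so small that the tail `⋃_{m > n} C m` cannot
exhaust `C n`. -/
lemma IsNonAtomic.exists_disjoint_subsets [SigmaFinite ν] (hν : IsNonAtomic ν) {D : ℕ → Set X}
    (hD : ∀ n, MeasurableSet (D n)) (hD0 : ∀ n, 0 < ν (D n)) :
    ∃ B : ℕ → Set X, (∀ n, MeasurableSet (B n)) ∧ (∀ n, B n ⊆ D n) ∧ (∀ n, 0 < ν (B n)) ∧
      (∀ n, ν (B n) < ∞) ∧ Pairwise (Function.onFun Disjoint B) := by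
  have small : ∀ (n : ℕ) (ε : {e : ℝ≥0∞ // e ≠ 0}),
      ∃ F ⊆ D n, MeasurableSet F ∧ 0 < ν F ∧ ν F < ε := fun n ε =>
    hν.exists_subset_measure_lt (hD n) (hD0 n) ε.2
  choose G hGD hG hG0 hGε using small
  have hne : ∀ n ε, ν (G n ε) / 4 ≠ 0 := fun n ε => by simp [(hG0 n ε).ne']
  let e : ℕ → {e : ℝ≥0∞ // e ≠ 0} := fun n =>
    Nat.rec ⟨1, one_ne_zero⟩ (fun n ε => ⟨ν (G n ε) / 4, hne n ε⟩) n
  let C : ℕ → Set X := fun n => G n (e n)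
  have hC0 : ∀ n, 0 < ν (C n) := fun n => hG0 n (e n)
  have hCsucc : ∀ n, ν (C (n + 1)) ≤ ν (C n) / 4 := fun n => (hGε (n + 1) (e (n + 1))).le
  have hCtop : ∀ n, ν (C n) < ∞ := fun n => lt_top_of_lt (hGε n (e n))
  have hCgeo : ∀ n k, ν (C (n + k)) ≤ ν (C n) * 4⁻¹ ^ k := by
    intro n k
    induction k with
    | zero => simp
    | succ k ih =>
      rw [← add_assoc, pow_succ, ← mul_assoc, ← div_eq_mul_inv]
      exact (hCsucc _).trans (by gcongr)
  have hR : ∀ n, ν (⋃ k, C (n + 1 + k)) < ν (C n) := by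
    intro n
    calc ν (⋃ k, C (n + 1 + k)) ≤ ∑' k, ν (C (n + 1 + k)) := measure_iUnion_le _
      _ ≤ ∑' k, ν (C n) * (4⁻¹ * 4⁻¹ ^ k) := by
        refine ENNReal.tsum_le_tsum fun k => ?_
        rw [← pow_succ', add_right_comm, add_assoc]
        exact hCgeo n (k + 1)
      _ = ν (C n) * (4⁻¹ * (1 - 4⁻¹)⁻¹) := by
        rw [ENNReal.tsum_mul_left, ENNReal.tsum_mul_left, ENNReal.tsum_geometric]
      _ < ν (C n) * 1 := by
        refine ENNReal.mul_lt_mul_right (hC0 n).ne' (hCtop n).ne ?_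
        have h4 : (1 - 4⁻¹ : ℝ≥0∞) = 3 * 4⁻¹ := by
          refine ENNReal.sub_eq_of_eq_add (by simp) ?_
          rw [← add_one_mul]
          norm_num
          exact (ENNReal.mul_inv_cancel (by simp) (by simp)).symm
        rw [h4, ENNReal.mul_inv (by simp) (by simp), inv_inv, mul_comm, mul_assoc,
          ENNReal.mul_inv_cancel (by simp) (by simp), mul_one]
        exact ENNReal.inv_lt_one.2 (by norm_num)
      _ = ν (C n) := mul_one _
  have hBC : ∀ n, C n \ ⋃ k, C (n + 1 + k) ⊆ C n := fun n => Set.sdiff_subset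
  refine ⟨fun n => C n \ ⋃ k, C (n + 1 + k), fun n => (hG _ _).diff (.iUnion fun k => hG _ _),
    fun n => (hBC n).trans (hGD _ _), fun n => ?_, fun n => (measure_mono (hBC n)).trans_lt
    (hCtop n), ?_⟩
  · refine pos_iff_ne_zero.2 fun h0 => ?_
    have := measure_le_inter_add_sdiff ν (C n) (⋃ k, C (n + 1 + k))
    rw [h0, add_zero] at this
    exact absurd ((this.trans (measure_mono Set.inter_subset_right)).trans_lt (hR n)) (lt_irrefl _)
  · refine (pairwise_disjoint_on _).2 fun m n hmn => ?_
    refine Set.disjoint_left.2 fun x hx hx' => hx.2 (Set.mem_iUnion.2 ⟨n - (m + 1), ?_⟩)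
    rw [Nat.add_sub_cancel' hmn]
    exact hx'.1

end NonAtomic

/-! ### Estimates for Young functions and modulars -/

lemma YoungFunction.exists_pos_eq (Φ : YoungFunction) {t : ℝ} (ht : 0 < t) :
    ∃ s : ℝ, 0 < s ∧ Φ s = t := by
  obtain ⟨b, hb0, hb⟩ :=
    ((Filter.eventually_gt_atTop 0).and (Φ.tendsto'.eventually_ge_atTop t)).exists
  obtain ⟨s, hs, hst⟩ := intermediate_value_Icc hb0.le Φ.continuous'.continuousOn
    (show t ∈ Set.Icc (Φ 0) (Φ b) from ⟨by rw [Φ.map_zero']; exact ht.le, hb⟩)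
  refine ⟨s, lt_of_le_of_ne hs.1 fun h => ?_, hst⟩
  rw [← h, Φ.map_zero'] at hst
  exact ht.ne hst

/-- An affine minorant of `Φ` with slope `Φ s / s`. -/
lemma YoungFunction.mul_le_mul_add (Φ : YoungFunction) {s t : ℝ} (hs : 0 < s) (ht : 0 ≤ t) :
    Φ s * t ≤ s * (Φ t + Φ s) := by
  rcases le_total t s with h | h
  · nlinarith [Φ.nonneg' t, Φ.nonneg' s]
  · have ht0 : 0 < t := hs.trans_le h
    have := Φ.scale (div_nonneg hs.le ht) ((div_le_one ht0).2 h) t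
    rw [div_mul_cancel₀ _ ht0.ne', div_mul_eq_mul_div, le_div_iff₀ ht0] at this
    nlinarith [Φ.nonneg' s]

section Modular

variable {X : Type*} {mX : MeasurableSpace X} {μ : Measure X}

/-- A substitute for Jensen's inequality: a large mean of `|g|` over `B` forces a large modular. -/
lemma mul_setLIntegral_enorm_le_modular (Φ : YoungFunction) {s c : ℝ} (hs : 0 < s) (hc : 0 ≤ c)
    (g : X →ₘ[μ] ℂ) (B : Set X) :
    ENNReal.ofReal (Φ s * c) * ∫⁻ x in B, ‖g x‖ₑ ∂μ
      ≤ ENNReal.ofReal s * (modular Φ c g + ENNReal.ofReal (Φ s) * μ B) := by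
  rw [← lintegral_const_mul'' _ g.aemeasurable.enorm.restrict]
  calc ∫⁻ x in B, ENNReal.ofReal (Φ s * c) * ‖g x‖ₑ ∂μ
      ≤ ∫⁻ x in B, ENNReal.ofReal s *
          (ENNReal.ofReal (Φ (c * ‖g x‖)) + ENNReal.ofReal (Φ s)) ∂μ := by
        refine lintegral_mono fun x => ?_
        simp only [← ofReal_norm]
        rw [← ENNReal.ofReal_mul (mul_nonneg (Φ.nonneg' _) hc),
          ← ENNReal.ofReal_add (Φ.nonneg' _) (Φ.nonneg' _), ← ENNReal.ofReal_mul hs.le, mul_assoc]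
        exact ENNReal.ofReal_le_ofReal (Φ.mul_le_mul_add hs (by positivity))
    _ = ENNReal.ofReal s * ((∫⁻ x in B, ENNReal.ofReal (Φ (c * ‖g x‖)) ∂μ)
          + ENNReal.ofReal (Φ s) * μ B) := by
        rw [lintegral_const_mul' _ _ ENNReal.ofReal_ne_top,
          lintegral_add_right _ measurable_const, setLIntegral_const]
    _ ≤ _ := by
        gcongr
        exact setLIntegral_le_lintegral _ _

end Modular

/-! ### Step functions -/

section StepFunction

variable {X : Type*}

/-- The function with the value `b n ≥ 0` on `B n`, for disjoint sets `B n`, and `0` elsewhere. The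
sum is taken in `[0, ∞]`, so that it needs no summability. -/
noncomputable def stepFun (B : ℕ → Set X) (b : ℕ → ℝ) (x : X) : ℝ :=
  (∑' n, (B n).indicator (fun _ => ENNReal.ofReal (b n)) x).toReal

lemma stepFun_of_mem {B : ℕ → Set X} (hB : Pairwise (Function.onFun Disjoint B)) {b : ℕ → ℝ}
    (hb : ∀ n, 0 ≤ b n) {n : ℕ} {x : X} (hx : x ∈ B n) : stepFun B b x = b n := by
  rw [stepFun, tsum_eq_single n, Set.indicator_of_mem hx, ENNReal.toReal_ofReal (hb n)]
  intro m hm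
  exact Set.indicator_of_notMem (Set.disjoint_right.1 (hB hm) hx) _

lemma stepFun_of_notMem {B : ℕ → Set X} {b : ℕ → ℝ} {x : X} (hx : ∀ n, x ∉ B n) :
    stepFun B b x = 0 := by
  simp [stepFun, hx]

lemma measurable_stepFun {𝒜 : MeasurableSpace X} {B : ℕ → Set X}
    (hB : ∀ n, MeasurableSet (B n)) (b : ℕ → ℝ) : Measurable (stepFun B b) :=
  (Measurable.tsum fun n => measurable_const.indicator (hB n)).ennreal_toReal

lemma lintegral_young_stepFun_le {mX : MeasurableSpace X} {μ : Measure X} (Φ : YoungFunction)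
    {B : ℕ → Set X} (hB : ∀ n, MeasurableSet (B n)) (hd : Pairwise (Function.onFun Disjoint B))
    {b : ℕ → ℝ} (hb : ∀ n, 0 ≤ b n) :
    ∫⁻ x, ENNReal.ofReal (Φ (stepFun B b x)) ∂μ ≤ ∑' n, ENNReal.ofReal (Φ (b n)) * μ (B n) := by
  calc ∫⁻ x, ENNReal.ofReal (Φ (stepFun B b x)) ∂μ
      ≤ ∫⁻ x, ∑' n, (B n).indicator (fun _ => ENNReal.ofReal (Φ (b n))) x ∂μ := by
        refine lintegral_mono fun x => ?_
        by_cases hx : ∃ n, x ∈ B n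
        · obtain ⟨n, hn⟩ := hx
          refine le_trans ?_ (ENNReal.le_tsum n)
          rw [stepFun_of_mem hd hb hn, Set.indicator_of_mem hn]
        · simp [stepFun_of_notMem (not_exists.1 hx), Φ.map_zero']
    _ = ∑' n, ENNReal.ofReal (Φ (b n)) * μ (B n) := by
        rw [lintegral_tsum fun n => (measurable_const.indicator (hB n)).aemeasurable]
        exact tsum_congr fun n => lintegral_indicator_const (hB n) _

end StepFunction

/-! ### Functions that are independent modulo the range -/

section Independence

variable {X : Type*} {𝒜 mX : MeasurableSpace X} {μ : Measure X}

/-- If `a n` is defined by `Φ (a n) μ (B n) = 2⁻ⁿ`, then `L^Φ` contains a sequence of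
`𝒜`-measurable functions, the `j`-th being `a n` on `B n` for those `n` with `(unpair n).1 = j` and
zero elsewhere. The conclusion describes their linear combinations. -/
lemma exists_block_functions (h𝒜 : 𝒜 ≤ mX) (Φ : YoungFunction) {B : ℕ → Set X}
    (hB : ∀ n, MeasurableSet[𝒜] (B n)) (hd : Pairwise (Function.onFun Disjoint B)) {a : ℕ → ℝ}
    (ha : ∀ n, 0 < a n) (haB : ∀ n, ENNReal.ofReal (Φ (a n)) * μ (B n) = 2⁻¹ ^ n) :
    ∃ f : ℕ → orliczSpace μ Φ, ∀ l : ℕ →₀ ℂ,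
      AEStronglyMeasurable[𝒜] (Finsupp.linearCombination ℂ f l : X →ₘ[μ] ℂ) μ ∧
      ∀ᵐ x ∂μ, ∀ n, x ∈ B n →
        (Finsupp.linearCombination ℂ f l : X →ₘ[μ] ℂ) x = l (Nat.unpair n).1 * a n := by
  let b : ℕ → ℕ → ℝ := fun j n => if (Nat.unpair n).1 = j then a n else 0
  have hb : ∀ j n, 0 ≤ b j n := fun j n => by
    simp only [b]
    split_ifs
    exacts [(ha n).le, le_rfl]
  have hm : ∀ j, Measurable[𝒜] fun x => (stepFun B (b j) x : ℂ) := fun j =>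
    Complex.measurable_ofReal.comp (measurable_stepFun hB (b j))
  let F : ℕ → X →ₘ[μ] ℂ := fun j =>
    AEEqFun.mk _ ((hm j).mono h𝒜 le_rfl).aestronglyMeasurable
  have hF : ∀ j, F j =ᵐ[μ] fun x => (stepFun B (b j) x : ℂ) := fun j => AEEqFun.coeFn_mk _ _
  have hmem : ∀ j, F j ∈ orliczSpace μ Φ := by
    intro j
    refine ⟨1, one_pos, lt_of_le_of_lt ?_ (show (2 : ℝ≥0∞) < ∞ by simp)⟩
    calc modular Φ 1 (F j) = ∫⁻ x, ENNReal.ofReal (Φ (stepFun B (b j) x)) ∂μ := by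
          refine lintegral_congr_ae ?_
          filter_upwards [hF j] with x hx
          rw [hx, one_mul, Complex.norm_real, Real.norm_of_nonneg (by exact ENNReal.toReal_nonneg)]
      _ ≤ ∑' n, ENNReal.ofReal (Φ (b j n)) * μ (B n) :=
          lintegral_young_stepFun_le Φ (fun n => h𝒜 _ (hB n)) hd (hb j)
      _ ≤ ∑' n, 2⁻¹ ^ n := by
          refine ENNReal.tsum_le_tsum fun n => ?_
          rw [← haB n]
          gcongr
          refine Φ.mono (hb j n) ?_
          simp only [b]
          split_ifs
          exacts [le_rfl, (ha n).le]
      _ = 2 := by rw [ENNReal.tsum_geometric, ENNReal.one_sub_inv_two, inv_inv]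
  refine ⟨fun j => ⟨F j, hmem j⟩, fun l => ?_⟩
  induction l using Finsupp.induction_linear with
  | zero =>
    rw [map_zero, ZeroMemClass.coe_zero]
    have h0 := AEEqFun.coeFn_zero (μ := μ) (β := ℂ) (α := X)
    refine ⟨⟨fun _ => 0, stronglyMeasurable_const, h0⟩, ?_⟩
    filter_upwards [h0] with x hx n _
    simp [hx]
  | add l₁ l₂ h₁ h₂ =>
    rw [map_add, Submodule.coe_add]
    have hadd := AEEqFun.coeFn_add
      (Finsupp.linearCombination ℂ (fun j => (⟨F j, hmem j⟩ : orliczSpace μ Φ)) l₁ : X →ₘ[μ] ℂ)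
      (Finsupp.linearCombination ℂ (fun j => (⟨F j, hmem j⟩ : orliczSpace μ Φ)) l₂ : X →ₘ[μ] ℂ)
    refine ⟨(h₁.1.add h₂.1).congr hadd.symm, ?_⟩
    filter_upwards [hadd, h₁.2, h₂.2] with x hx e₁ e₂ n hn
    rw [hx, Pi.add_apply, e₁ n hn, e₂ n hn, Finsupp.add_apply, add_mul]
  | single j c =>
    rw [Finsupp.linearCombination_single, Submodule.coe_smul]
    have hsmul := AEEqFun.coeFn_smul c (F j)
    refine ⟨⟨fun x => c * (stepFun B (b j) x : ℂ),
      (measurable_const.mul (hm j)).stronglyMeasurable, ?_⟩, ?_⟩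
    · filter_upwards [hsmul, hF j] with x h1 h2
      rw [h1, Pi.smul_apply, h2, smul_eq_mul]
    · filter_upwards [hsmul, hF j] with x h1 h2 n hn
      rw [h1, Pi.smul_apply, h2, stepFun_of_mem hd (hb j) hn, smul_eq_mul, Finsupp.single_apply]
      simp only [b]
      by_cases hj : (Nat.unpair n).1 = j
      · simp [hj]
      · simp [hj, Ne.symm hj]

/-- If `|w| < 4⁻ⁿ` and `κ a ≤ |w E(g)|` on `B`, where `Φ(a) μ(B) = 2⁻ⁿ`, then `|E(g)|` is of order
`4ⁿ a` on `B`, and the modular of `g` is at least of order `2ⁿ`. -/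
lemma two_pow_le_of_le_norm_condE (h𝒜 : 𝒜 ≤ mX) [SigmaFinite (μ.trim h𝒜)] (Φ : YoungFunction)
    {g w : X →ₘ[μ] ℂ} {c κ a : ℝ} (hc : 0 < c) (hκ : 0 < κ) (ha : 0 < a)
    (hg : modular Φ c g < ∞) {B : Set X} (hB : MeasurableSet[𝒜] B) {n : ℕ}
    (haB : ENNReal.ofReal (Φ a) * μ B = 2⁻¹ ^ n)
    (hw : ∀ᵐ x ∂μ, x ∈ B → ‖w x‖ < (4⁻¹ : ℝ) ^ n)
    (hwg : ∀ᵐ x ∂μ, x ∈ B → κ * a ≤ ‖w x‖ * ‖condE 𝒜 g x‖) :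
    c * κ * 2 ^ n ≤ 2 * ((modular Φ c g).toReal + 1) := by
  have low : ∀ᵐ x ∂μ, x ∈ B → ENNReal.ofReal (κ * a * 4 ^ n) ≤ ‖condE 𝒜 g x‖ₑ := by
    filter_upwards [hw, hwg] with x h1 h2 hx
    rw [← ofReal_norm]
    refine ENNReal.ofReal_le_ofReal ?_
    have h3 := (h2 hx).trans (mul_le_mul_of_nonneg_right (h1 hx).le (norm_nonneg _))
    rwa [inv_pow, inv_mul_eq_div, le_div_iff₀ (by positivity)] at h3
  have mean : ENNReal.ofReal (κ * a * 4 ^ n) * μ B ≤ 2 * ∫⁻ x in B, ‖g x‖ₑ ∂μ := by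
    rw [← setLIntegral_const]
    exact (setLIntegral_mono_ae' (h𝒜 _ hB) low).trans (setLIntegral_enorm_condE_le h𝒜 g hB)
  have hΦ := Φ.nonneg' a
  have h2n : (2⁻¹ : ℝ≥0∞) ^ n = ENNReal.ofReal (2⁻¹ ^ n) := by
    rw [ENNReal.ofReal_pow (by norm_num), ENNReal.ofReal_inv_of_pos two_pos, ENNReal.ofReal_ofNat]
  have main : ENNReal.ofReal (c * κ * a * 2 ^ n)
      ≤ ENNReal.ofReal (2 * (a * ((modular Φ c g).toReal + 2⁻¹ ^ n))) := by
    calc ENNReal.ofReal (c * κ * a * 2 ^ n)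
        = ENNReal.ofReal (c * (κ * a * 4 ^ n)) * ENNReal.ofReal (2⁻¹ ^ n) := by
          rw [← ENNReal.ofReal_mul (by positivity)]
          congr 1
          rw [show (4 : ℝ) = 2 * 2 by norm_num, mul_pow, inv_pow]
          field_simp
      _ = ENNReal.ofReal (Φ a * c) * (ENNReal.ofReal (κ * a * 4 ^ n) * μ B) := by
          rw [← h2n, ← haB, ENNReal.ofReal_mul hc.le, ENNReal.ofReal_mul hΦ]
          ring
      _ ≤ ENNReal.ofReal (Φ a * c) * (2 * ∫⁻ x in B, ‖g x‖ₑ ∂μ) := by gcongr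
      _ = 2 * (ENNReal.ofReal (Φ a * c) * ∫⁻ x in B, ‖g x‖ₑ ∂μ) := by ring
      _ ≤ 2 * (ENNReal.ofReal a * (modular Φ c g + ENNReal.ofReal (Φ a) * μ B)) := by
          gcongr 2 * ?_
          exact mul_setLIntegral_enorm_le_modular Φ ha hc.le g B
      _ = _ := by
          rw [haB, h2n, ENNReal.ofReal_mul zero_le_two, ENNReal.ofReal_mul ha.le,
            ENNReal.ofReal_add ENNReal.toReal_nonneg (by positivity), ENNReal.ofReal_toReal hg.ne,
            ENNReal.ofReal_ofNat]
  have h := (ENNReal.ofReal_le_ofReal_iff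
    (mul_nonneg zero_le_two (mul_nonneg ha.le (add_nonneg ENNReal.toReal_nonneg
      (by positivity))))).1 main
  have h1 : (2⁻¹ : ℝ) ^ n ≤ 1 := pow_le_one₀ (by norm_num) (by norm_num)
  have h2 : a * (c * κ * 2 ^ n) ≤ a * (2 * ((modular Φ c g).toReal + 2⁻¹ ^ n)) := by linarith
  linarith [le_of_mul_le_mul_left h2 ha]

end Independence

end LambertOrlicz

theorem theorem3p2 {X : Type*} (𝒜 : MeasurableSpace X) {mX : MeasurableSpace X}
    (μ : MeasureTheory.Measure X) [MeasureTheory.SigmaFinite μ] [μ.IsComplete]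
    (h𝒜 : 𝒜 ≤ mX) [MeasureTheory.SigmaFinite (μ.trim h𝒜)] [(μ.trim h𝒜).IsComplete]
    (hna : LambertOrlicz.IsNonAtomic (μ.trim h𝒜))
    (Φ : LambertOrlicz.YoungFunction) (hΦ : Φ.DeltaTwo)
    (u : X →ₘ[μ] ℂ) (hu : LambertOrlicz.IsLambertMultiplier 𝒜 Φ Φ u)
    (hT : LambertOrlicz.IsFredholmOp (LambertOrlicz.starMulOp hu)) :
    ∃ δ : ℝ, 0 < δ ∧ ∀ᵐ x ∂μ, δ ≤ ‖LambertOrlicz.condE 𝒜 u x‖ := by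
  open LambertOrlicz in
  by_contra! hcon
  obtain ⟨w, hw, huw⟩ := aestronglyMeasurable_condE (𝒜 := 𝒜) u
  have hD : ∀ n : ℕ, MeasurableSet[𝒜] {x | ‖w x‖ < (4⁻¹ : ℝ) ^ n} := fun n =>
    measurableSet_lt (measurable_norm.comp hw.measurable) measurable_const
  have hD0 : ∀ n : ℕ, 0 < μ.trim h𝒜 {x | ‖w x‖ < (4⁻¹ : ℝ) ^ n} := by
    intro n
    rw [trim_measurableSet_eq h𝒜 (hD n)]
    refine pos_iff_ne_zero.2 fun h0 => hcon _ (show (0 : ℝ) < 4⁻¹ ^ n by positivity) ?_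
    filter_upwards [measure_eq_zero_iff_ae_notMem.1 h0, huw] with x h1 h2
    rw [h2]
    exact h1
  -- disjoint `B n ∈ 𝒜` with `|E(u)| < 4⁻ⁿ` on `B n`
  obtain ⟨B, hB, hBD, hB0, hBtop, hd⟩ := hna.exists_disjoint_subsets hD hD0
  have htrim : ∀ n, μ.trim h𝒜 (B n) = μ (B n) := fun n => trim_measurableSet_eq h𝒜 (hB n)
  simp only [htrim] at hB0 hBtop
  have hBr : ∀ n, 0 < (μ (B n)).toReal := fun n => ENNReal.toReal_pos (hB0 n).ne' (hBtop n).ne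
  have hex : ∀ n : ℕ, ∃ a : ℝ, 0 < a ∧ ENNReal.ofReal (Φ a) * μ (B n) = 2⁻¹ ^ n := by
    intro n
    obtain ⟨a, ha, hΦa⟩ := Φ.exists_pos_eq (div_pos (show (0 : ℝ) < 2⁻¹ ^ n by positivity) (hBr n))
    refine ⟨a, ha, ?_⟩
    have hb := hBr n
    rw [hΦa, ← ENNReal.ofReal_toReal (hBtop n).ne, ← ENNReal.ofReal_mul (by positivity),
      ENNReal.toReal_ofReal ENNReal.toReal_nonneg, div_mul_cancel₀ _ (hBr n).ne',
      ENNReal.ofReal_pow (by norm_num), ENNReal.ofReal_inv_of_pos two_pos, ENNReal.ofReal_ofNat]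
  choose a ha haB using hex
  obtain ⟨f, hf⟩ := exists_block_functions h𝒜 Φ hB hd ha haB
  have hli : LinearIndependent ℂ fun j => (LinearMap.range (starMulOp hu)).mkQ (f j) := by
    rw [linearIndependent_iff]
    intro l hl
    have hl' : (LinearMap.range (starMulOp hu)).mkQ (Finsupp.linearCombination ℂ f l) = 0 := by
      rw [← hl, Finsupp.apply_linearCombination]
      rfl
    rw [Submodule.mkQ_apply, Submodule.Quotient.mk_eq_zero] at hl'
    obtain ⟨g, hg⟩ := hl'
    obtain ⟨hlm, hlv⟩ := hf l
    -- apply the conditional expectation to `u * g = ∑ l j • f j`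
    have hE : condE 𝒜 u * condE 𝒜 (g : X →ₘ[μ] ℂ)
        = (Finsupp.linearCombination ℂ f l : X →ₘ[μ] ℂ) := by
      rw [← condE_starMul h𝒜 hu.1 (orliczSpace_le_conditionable Φ g.2),
        ← condE_of_aestronglyMeasurable h𝒜 hlm, ← hg]
      rfl
    obtain ⟨c, hc, hgc⟩ := g.2
    by_contra hl0
    obtain ⟨j, hj⟩ := Finsupp.ne_iff.1 hl0
    have hκ : 0 < ‖l j‖ := norm_pos_iff.2 hj
    have bound : ∀ m : ℕ,
        c * ‖l j‖ * 2 ^ m ≤ 2 * ((modular Φ c (g : X →ₘ[μ] ℂ)).toReal + 1) := by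
      intro m
      refine le_trans ?_ (two_pow_le_of_le_norm_condE h𝒜 Φ (w := condE 𝒜 u) hc hκ
        (ha (Nat.pair j m)) hgc (hB _) (haB _) ?_ ?_)
      · gcongr
        exacts [one_le_two, Nat.right_le_pair j m]
      · filter_upwards [huw] with x hx hxB
        rw [hx]
        exact hBD _ hxB
      · filter_upwards [hlv, AEEqFun.coeFn_mul (condE 𝒜 u) (condE 𝒜 (g : X →ₘ[μ] ℂ))]
          with x h1 h2 hxB
        rw [← norm_mul, ← Pi.mul_apply (f := condE 𝒜 u), ← h2, hE, h1 _ hxB, norm_mul,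
          Nat.unpair_pair, Complex.norm_real, Real.norm_of_nonneg (ha _).le]
    obtain ⟨m, hm⟩ := pow_unbounded_of_one_lt
      (2 * ((modular Φ c (g : X →ₘ[μ] ℂ)).toReal + 1) / (c * ‖l j‖)) (one_lt_two (α := ℝ))
    rw [div_lt_iff₀' (by positivity)] at hm
    exact absurd (bound m) (not_le.2 hm)
  have := hT.finite_coker
  have := hli.finite
  exact not_finite ℕ
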